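/- For $d\ge 2$ let $F_d\subset[0,1]^d$ be the Fibonacci polytope, defined by $x_i+x_{i+1}\le 1$ for $1\le i\le d-1$. Let $E_d$ be the Euler (zigzag) numbers, given by $\sec x+\tan x=\sum_{d\ge0}\frac{E_d}{d!}x^d$. Call a permutation $\sigma$ of $\{1,\dots,d\}$ alternating if $\sigma(1)>\sigma(2)<\sigma(3)>\cdots$, let $\operatorname{swap}(\sigma)$ be the number of $i<d$ with $\sigma^{-1}(i)<\sigma^{-1}(i+1)-1$, and let $s_d(m)$ be the number of alternating permutations $\sigma$ of $\{1,\dots,d\}$ with $\operatorname{swap}(\sigma)=m$. Then there is a polynomial $P_d\in\mathbb{Q}[x]$ (the Ehrhart polynomial of $F_d$) such that $P_d(k)=\#(kF_d\cap\mathbb{Z}^d)$ for all integers $k\ge 0$, and $$P_d(k)=\frac{E_d}{d!}k^d+\frac32\,\frac{E_d}{(d-1)!}k^{d-1}+\frac1{(d-2)!}\left(E_d\,\frac{-3d^2+17d+2}{24}+\sum_{m=0}^{d-2}\binom m2 s_d(m)\right)k^{d-2}+O(k^{d-3}),$$ where $O(k^{d-3})$ stands for a polynomial in $k$ of degree less than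 $d-2$ (the zero polynomial if $d=2$). In particular, with the same meaning of $O$, $$P_d\left(x-\tfrac32\right)=\frac{E_d}{d!}x^d+\frac1{(d-2)!}\left(E_d\,\frac{-3d^2+17d-25}{24}+\sum_{m=0}^{d-2}\binom m2 s_d(m)\right)x^{d-2}+O(x^{d-3}),$$ so $P_d(x-\frac32)$ has no $x^{d-1}$ term. -/

import Mathlib

open Finset Polynomial
open scoped Pointwise

/-- The `d`-dimensional Fibonacci polytope: the points of `[0,1]^d` with
`x_i + x_{i+1} ≤ 1` for all consecutive coordinates. -/
def fibonacciPolytope (d : ℕ) : Set (Fin d → ℝ) :=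
  {x | (∀ i, x i ∈ Set.Icc (0 : ℝ) 1) ∧
    ∀ (i : Fin d) (h : (i : ℕ) + 1 < d), x i + x ⟨(i : ℕ) + 1, h⟩ ≤ 1}

/-- The integer points of a subset of `ℝ^d`. -/
def integerPoints {d : ℕ} (S : Set (Fin d → ℝ)) : Set (Fin d → ℤ) :=
  {z | (fun i => (z i : ℝ)) ∈ S}

/-- `P` is the Ehrhart polynomial of the (bounded) set `S`: its value at each natural number `k` is
the number of integer points of the dilation `k S`. Such a `P` is unique, since it is determined
at infinitely many arguments. -/
def IsEhrhartPolynomial {d : ℕ} (S : Set (Fin d → ℝ)) (P : ℚ[X]) : Prop :=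
  ∀ k : ℕ, P.eval (k : ℚ) = ((integerPoints ((k : ℝ) • S)).ncard : ℚ)

/-- The Euler (zigzag) numbers, given by the Taylor-Maclaurin series
`sec x + tan x = ∑ E_d / d! x^d`. -/
noncomputable def eulerZigzag (d : ℕ) : ℚ :=
  (d.factorial : ℚ) *
    PowerSeries.coeff d ((PowerSeries.cos ℚ)⁻¹ + PowerSeries.sin ℚ * (PowerSeries.cos ℚ)⁻¹)

/-- A permutation, in one-line notation `σ_1 σ_2 … σ_d`, is alternating if
`σ_1 > σ_2 < σ_3 > ⋯`. Positions are numbered from `0` here. -/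
def IsAlternating {d : ℕ} (σ : Equiv.Perm (Fin d)) : Prop :=
  ∀ (i : Fin d) (h : (i : ℕ) + 1 < d),
    if Even (i : ℕ) then σ ⟨(i : ℕ) + 1, h⟩ < σ i else σ i < σ ⟨(i : ℕ) + 1, h⟩

instance {d : ℕ} (σ : Equiv.Perm (Fin d)) : Decidable (IsAlternating σ) := by
  unfold IsAlternating
  infer_instance

/-- The swap statistic: the number of values `i`, with `i + 1` also a value, such that
`σ⁻¹(i) < σ⁻¹(i + 1) - 1`. -/
def swapStat {d : ℕ} (σ : Equiv.Perm (Fin d)) : ℕ :=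
  #{i : Fin d | ∃ h : (i : ℕ) + 1 < d,
    ((σ.symm i : Fin d) : ℕ) + 1 < ((σ.symm ⟨(i : ℕ) + 1, h⟩ : Fin d) : ℕ)}

/-- `s_d(m)`: the number of alternating permutations of `d` letters with swap statistic `m`. -/
def swapCount (d m : ℕ) : ℕ :=
  #{σ : Equiv.Perm (Fin d) | IsAlternating σ ∧ swapStat σ = m}

/-! Replacing `x_i` by `k - x_i` at even positions (counted from `0`) turns the integer points of `k
F_d` into the words `y_0 ≥ y_1 ≤ y_2 ≥ ⋯` with letters in `{0, …, k}`, that is, the `P`-partitions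
of the zigzag poset. Sorting a word, with ties broken by a suitable labelling of the positions,
attaches to it an alternating permutation `σ`. The words attached to `σ` are weakly increasing
sequences forced to be strict at each swap, so there are `C(k + d - swap σ, d)` of them
(`card_isWeakZigzag`). Hence the Ehrhart polynomial is `∑ C(k + d - swap σ, d)` over the alternating
`σ`, and its three top coefficients depend only on the number of such `σ` and on the first two
moments of `swap`.

The number is `E_d` (`card_alternatingPerms`): by a Riemann-sum argument the leading coefficient is
`p_d(1)`, where `p_{d+1}(x) = ∫_0^x p_d(1 - s) ds`, and `∑ p_d(1) t^d = sec t + tan t`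
(`mk_eval_one_zigzagPoly`).

The mean is `(d - 2)/2` (`two_mul_sum_swapStat`): lowering the peaks by one identifies strict zigzag
words on `k + 2` letters with weak ones on `k + 1` letters, and strict words are counted with `swap`
replaced by its complement.

The second moment is left in the formula, as the sum of `C(m, 2) s_d(m)`. -/

/-! ### Words with constraints on consecutive letters -/

open scoped Classical in
/-- The words of length `d` in the letters `0, …, M - 1` whose consecutive letters, at positions `i`
and `i + 1`, are related by `R i`. -/
noncomputable def chainWords (R : ℕ → ℕ → ℕ → Prop) (M d : ℕ) : Finset (Fin d → ℕ) :=
  {g ∈ Fintype.piFinset fun _ : Fin d => range M |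
    ∀ (i : Fin d) (h : (i : ℕ) + 1 < d), R i (g i) (g ⟨i + 1, h⟩)}

theorem mem_chainWords {R : ℕ → ℕ → ℕ → Prop} {M d : ℕ} {g : Fin d → ℕ} :
    g ∈ chainWords R M d ↔ (∀ i, g i < M) ∧
      ∀ (i : Fin d) (h : (i : ℕ) + 1 < d), R i (g i) (g ⟨i + 1, h⟩) := by
  simp [chainWords]

/-- The number of chain words of length `d + 1` with last letter `b`. -/
noncomputable def chainCount (R : ℕ → ℕ → ℕ → Prop) (M d b : ℕ) : ℕ :=
  #{g ∈ chainWords R M (d + 1) | g (Fin.last d) = b}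

theorem chainCount_zero (R : ℕ → ℕ → ℕ → Prop) {M b : ℕ} (hb : b < M) :
    chainCount R M 0 b = 1 := by
  rw [chainCount, card_eq_one]
  refine ⟨fun _ => b, ?_⟩
  ext g
  simp only [mem_filter, mem_chainWords, mem_singleton]
  constructor
  · rintro ⟨-, h⟩
    funext i
    exact (congrArg g (Subsingleton.elim (α := Fin 1) i (Fin.last 0))).trans h
  · rintro rfl
    exact ⟨⟨fun _ => hb, fun i h => by omega⟩, rfl⟩

open scoped Classical in
theorem chainCount_succ (R : ℕ → ℕ → ℕ → Prop) {M b : ℕ} (d : ℕ) (hb : b < M) :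
    chainCount R M (d + 1) b = ∑ a ∈ range M with R d a b, chainCount R M d a := by
  rw [chainCount, card_eq_sum_card_fiberwise (f := fun g => g (Fin.last d).castSucc)
    (t := {a ∈ range M | R d a b})]
  · refine sum_congr rfl fun a ha => ?_
    rw [mem_filter, mem_range] at ha
    rw [chainCount]
    refine card_bij' (fun g _ => Fin.init g) (fun g _ => Fin.snoc (α := fun _ => ℕ) g b)
      ?_ ?_ ?_ ?_
    · intro g hg
      simp only [mem_filter, mem_chainWords] at hg ⊢
      refine ⟨⟨fun i => hg.1.1.1 _, fun i h => ?_⟩, hg.2⟩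
      exact hg.1.1.2 i.castSucc (by simp; omega)
    · intro g hg
      simp only [mem_filter, mem_chainWords] at hg ⊢
      refine ⟨⟨⟨fun i => ?_, fun i h => ?_⟩, by simp⟩, by simp [hg.2]⟩
      · induction i using Fin.lastCases with
        | last => simpa using hb
        | cast i => simpa using hg.1.1 i
      · obtain ⟨i, hi⟩ := i
        simp only at h
        by_cases h' : i + 1 < d + 1
        · have := hg.1.2 ⟨i, by omega⟩ h'
          simpa [Fin.snoc, h', show i < d + 1 by omega] using this
        · obtain rfl : i = d := by omega
          have h2 := hg.2
          simp only [Fin.snoc, show i < i + 1 by omega, dite_true, lt_irrefl, dite_false, cast_eq,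
            Fin.castLT]
          have : (⟨i, by omega⟩ : Fin (i + 1)) = Fin.last i := rfl
          rw [this, h2]
          exact ha.2
    · intro g hg
      simp only [mem_filter] at hg
      rw [← hg.1.2]
      exact Fin.snoc_init_self g
    · intro g _
      exact Fin.init_snoc (α := fun _ => ℕ) _ _
  · intro g hg
    simp only [coe_filter, Set.mem_ofPred_eq, mem_chainWords, mem_range] at hg ⊢
    refine ⟨hg.1.1 _, ?_⟩
    have := hg.1.2 (Fin.last d).castSucc (by simp)
    rw [← hg.2]
    exact this

theorem card_chainWords_succ (R : ℕ → ℕ → ℕ → Prop) (M d : ℕ) :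
    #(chainWords R M (d + 1)) = ∑ b ∈ range M, chainCount R M d b :=
  card_eq_sum_card_fiberwise fun g hg => by
    simpa using (mem_chainWords.1 hg).1 _

/-- Hockey-stick identity; `t ≤ d` makes the boundary term `C(t, d + 1)` vanish. -/
theorem sum_range_add_choose_eq {t d : ℕ} (h : t ≤ d) (n : ℕ) :
    ∑ j ∈ range n, (j + t).choose d = (n + t).choose (d + 1) := by
  induction n with
  | zero => simp [Nat.choose_eq_zero_of_lt (show t < d + 1 by omega)]
  | succ n ih =>
    rw [sum_range_succ, ih, show n + 1 + t = (n + t) + 1 by ring, Nat.choose_succ_succ, add_comm]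

/-- Each step sums a binomial coefficient over the previous letter. A weak step raises the upper
index by one and a strict step does not; the subtraction is never truncated, since `δ ≤ 1`. -/
theorem chainCount_add_le (δ : ℕ → ℕ) (hδ : ∀ i, δ i ≤ 1) {M : ℕ} (d : ℕ) {b : ℕ} (hb : b < M) :
    chainCount (fun i a b => a + δ i ≤ b) M d b = (b + (d - ∑ i ∈ range d, δ i)).choose d := by
  induction d generalizing b with
  | zero => simp [chainCount_zero _ hb]
  | succ d ih =>
    have hs : ∑ i ∈ range d, δ i ≤ d := by
      simpa using sum_le_sum fun i (_ : i ∈ range d) => hδ i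
    have hd := hδ d
    rw [chainCount_succ _ _ hb, sum_congr (s₂ := range (b + 1 - δ d))
        (by ext a; simp only [mem_filter, mem_range]; omega)
        fun a ha => ih (by rw [mem_range] at ha; omega),
      sum_range_add_choose_eq (by omega), sum_range_succ]
    congr 1
    omega

theorem card_chainWords_add_le (δ : ℕ → ℕ) (hδ : ∀ i, δ i ≤ 1) (M d : ℕ) :
    #(chainWords (fun i a b => a + δ i ≤ b) M (d + 1)) =
      (M + (d - ∑ i ∈ range d, δ i)).choose (d + 1) := by
  rw [card_chainWords_succ, sum_congr rfl fun b hb => chainCount_add_le δ hδ d (mem_range.1 hb),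
    sum_range_add_choose_eq (by omega)]

/-! ### Sorting words: the fundamental lemma of `P`-partitions -/

/-- `σ` ranks the positions by the letters of the word `f`, ties being broken by the labels `ω`. -/
def IsRanking {d : ℕ} (ω : Fin d → ℤ) (f : Fin d → ℕ) (σ : Equiv.Perm (Fin d)) : Prop :=
  ∀ i j, σ i < σ j ↔ f i < f j ∨ f i = f j ∧ ω i < ω j

/-- The ranking of the positions by the letters of a word, ties being broken by labels. -/
def ranking {d : ℕ} (ω : Fin d → ℤ) (f : Fin d → ℕ) : Equiv.Perm (Fin d) :=
  (Tuple.sort fun p => toLex (f p, ω p)).symm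

theorem isRanking_ranking {d : ℕ} {ω : Fin d → ℤ} (hω : Function.Injective ω) (f : Fin d → ℕ) :
    IsRanking ω f (ranking ω f) := by
  set key : Fin d → ℕ ×ₗ ℤ := fun p => toLex (f p, ω p)
  have hinj : Function.Injective key := fun i j h =>
    hω (by simpa [key] using (congrArg Prod.snd (toLex.injective h)))
  have hmono : StrictMono (key ∘ Tuple.sort key) :=
    (Tuple.monotone_sort key).strictMono_of_injective (hinj.comp (Equiv.injective _))
  intro i j
  have := hmono.lt_iff_lt (a := ranking ω f i) (b := ranking ω f j)
  rw [← this]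
  simp [ranking, key, Prod.Lex.toLex_lt_toLex]

theorem ranking_eq_iff {n : ℕ} {ω : Fin (n + 1) → ℤ} (hω : Function.Injective ω)
    (f : Fin (n + 1) → ℕ) (σ : Equiv.Perm (Fin (n + 1))) :
    ranking ω f = σ ↔ ∀ i : Fin n, f (σ.symm i.castSucc) < f (σ.symm i.succ) ∨
      f (σ.symm i.castSucc) = f (σ.symm i.succ) ∧ ω (σ.symm i.castSucc) < ω (σ.symm i.succ) := by
  constructor
  · rintro rfl i
    rw [← isRanking_ranking hω f]
    simp
  · intro h
    have hmono : StrictMono ((fun p => toLex (f p, ω p)) ∘ σ.symm) := by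
      rw [Fin.strictMono_iff_lt_succ]
      intro i
      simpa [Prod.Lex.toLex_lt_toLex] using h i
    rw [ranking, ← Tuple.eq_sort_iff.2
      ⟨hmono.monotone, fun i j hij he => absurd he (hmono hij).ne⟩, Equiv.symm_symm]

open scoped Classical in
/-- The indicator of a descent of the labels, listed in the order of the ranks, at rank `i`. -/
noncomputable def descentIndicator {d : ℕ} (ω : Fin d → ℤ) (σ : Equiv.Perm (Fin d)) (i : ℕ) : ℕ :=
  if ∃ h : i + 1 < d, ω (σ.symm ⟨i + 1, h⟩) < ω (σ.symm ⟨i, by omega⟩) then 1 else 0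

/-- Read in the order of the ranks, such a word is weakly increasing, and a tie is allowed exactly
where the labels ascend; descents therefore force strict steps. -/
theorem card_ranking_eq {n : ℕ} {ω : Fin (n + 1) → ℤ} (hω : Function.Injective ω) (M : ℕ)
    (σ : Equiv.Perm (Fin (n + 1))) :
    #{f ∈ Fintype.piFinset fun _ : Fin (n + 1) => range M | ranking ω f = σ} =
      (M + (n - ∑ i ∈ range n, descentIndicator ω σ i)).choose (n + 1) := by
  rw [← card_chainWords_add_le _ (fun i => by unfold descentIndicator; split_ifs <;> simp)]
  refine card_bij' (fun f _ => f ∘ σ.symm) (fun g _ => g ∘ σ) ?_ ?_ ?_ ?_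
  · intro f hf
    rw [mem_filter, Fintype.mem_piFinset, ranking_eq_iff hω] at hf
    rw [mem_chainWords]
    refine ⟨fun i => by simpa using hf.1 _, fun i hi => ?_⟩
    have := hf.2 ⟨i, by omega⟩
    simp only [Fin.castSucc_mk, Fin.succ_mk, Fin.eta] at this
    simp only [Function.comp_apply, descentIndicator]
    split_ifs with h
    · obtain ⟨_, h⟩ := h
      simp only [Fin.eta] at h
      omega
    · omega
  · intro g hg
    rw [mem_chainWords] at hg
    rw [mem_filter, Fintype.mem_piFinset, ranking_eq_iff hω]
    refine ⟨fun i => by simpa using hg.1 _, fun i => ?_⟩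
    have := hg.2 i.castSucc (by simp)
    have e' : (⟨(i : ℕ), by omega⟩ : Fin (n + 1)) = i.castSucc := rfl
    have e'' : (⟨(i : ℕ) + 1, by omega⟩ : Fin (n + 1)) = i.succ := rfl
    have hne : ω (σ.symm i.castSucc) ≠ ω (σ.symm i.succ) := fun h => by
      have := σ.symm.injective (hω h)
      exact absurd this (Fin.castSucc_lt_succ).ne
    simp only [descentIndicator, Fin.val_castSucc, e', e''] at this
    simp only [Function.comp_apply, Equiv.apply_symm_apply]
    split_ifs at this with h
    · exact Or.inl this
    · have h' : ¬ ω (σ.symm i.succ) < ω (σ.symm i.castSucc) := fun h' => h ⟨by omega, h'⟩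
      have := lt_of_le_of_ne (not_lt.1 h') hne
      omega
  · intro f _
    funext i
    simp
  · intro f _
    funext i
    simp

open scoped Classical in
/-- Counting words by their rankings: if a property of words is equivalent to a property of their
rankings, the words with this property are counted by binomial coefficients. -/
theorem card_words_eq_sum_choose {n : ℕ} {ω : Fin (n + 1) → ℤ} (hω : Function.Injective ω) (M : ℕ)
    (Z : (Fin (n + 1) → ℕ) → Prop) (L : Equiv.Perm (Fin (n + 1)) → Prop)
    (h : ∀ f σ, IsRanking ω f σ → (Z f ↔ L σ)) :
    #{f ∈ Fintype.piFinset fun _ : Fin (n + 1) => range M | Z f} =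
      ∑ σ with L σ, (M + (n - ∑ i ∈ range n, descentIndicator ω σ i)).choose (n + 1) := by
  rw [card_eq_sum_card_fiberwise (f := ranking ω) (t := univ.filter L)]
  · refine sum_congr rfl fun σ hσ => ?_
    rw [← card_ranking_eq hω, filter_filter]
    congr 1
    refine filter_congr fun f _ => ⟨fun h => h.2, ?_⟩
    rintro rfl
    exact ⟨(h f _ (isRanking_ranking hω f)).2 (mem_filter.1 hσ).2, rfl⟩
  · intro f hf
    simp only [coe_filter, Set.mem_ofPred_eq] at hf
    simpa using (h f _ (isRanking_ranking hω f)).1 hf.2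

/-! ### Zigzag words and the swap statistic -/

/-- A word `y_0 ≥ y_1 ≤ y_2 ≥ ⋯`. -/
def IsWeakZigzag {d : ℕ} (f : Fin d → ℕ) : Prop :=
  ∀ (i : Fin d) (h : (i : ℕ) + 1 < d),
    if Even (i : ℕ) then f ⟨(i : ℕ) + 1, h⟩ ≤ f i else f i ≤ f ⟨(i : ℕ) + 1, h⟩

/-- A word `y_0 > y_1 < y_2 > ⋯`. -/
def IsStrictZigzag {d : ℕ} (f : Fin d → ℕ) : Prop :=
  ∀ (i : Fin d) (h : (i : ℕ) + 1 < d),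
    if Even (i : ℕ) then f ⟨(i : ℕ) + 1, h⟩ < f i else f i < f ⟨(i : ℕ) + 1, h⟩

/-- A natural labelling of the zigzag poset whose descents along linear extensions are the
swaps. -/
def zigzagLabel {d : ℕ} (i : Fin d) : ℤ :=
  if (i : ℕ) = 0 then 0 else if Even (i : ℕ) then 1 - (i : ℕ) else -1 - (i : ℕ)

theorem zigzagLabel_injective {d : ℕ} : Function.Injective (zigzagLabel : Fin d → ℤ) := by
  intro i j h
  apply Fin.ext
  unfold zigzagLabel at h
  split_ifs at h <;> simp only [Nat.even_iff] at * <;> omega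

theorem zigzagLabel_succ_lt {d : ℕ} {i : Fin d} (h : (i : ℕ) + 1 < d) (hi : Even (i : ℕ)) :
    zigzagLabel (⟨i + 1, h⟩ : Fin d) < zigzagLabel i := by
  unfold zigzagLabel
  simp only [Nat.even_iff] at *
  push_cast
  split_ifs <;> omega

theorem zigzagLabel_lt_succ {d : ℕ} {i : Fin d} (h : (i : ℕ) + 1 < d) (hi : ¬ Even (i : ℕ)) :
    zigzagLabel i < zigzagLabel (⟨i + 1, h⟩ : Fin d) := by
  unfold zigzagLabel
  simp only [Nat.even_iff] at *
  push_cast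
  split_ifs <;> omega

theorem isWeakZigzag_iff_isAlternating {d : ℕ} {f : Fin d → ℕ} {σ : Equiv.Perm (Fin d)}
    (h : IsRanking zigzagLabel f σ) : IsWeakZigzag f ↔ IsAlternating σ := by
  refine forall_congr' fun i => forall_congr' fun hi => ?_
  rw [h, h]
  split_ifs with he
  · simp [zigzagLabel_succ_lt hi he, le_iff_lt_or_eq]
  · simp [zigzagLabel_lt_succ hi he, le_iff_lt_or_eq]

/-- With the negated labels, a tie between neighbours is ranked against the zigzag order, so an
alternating ranking excludes ties. -/
theorem isStrictZigzag_iff_isAlternating {d : ℕ} {f : Fin d → ℕ} {σ : Equiv.Perm (Fin d)}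
    (h : IsRanking (fun i => -zigzagLabel i) f σ) : IsStrictZigzag f ↔ IsAlternating σ := by
  refine forall_congr' fun i => forall_congr' fun hi => ?_
  rw [h, h]
  split_ifs with he
  · simp [(zigzagLabel_succ_lt hi he).le]
  · simp [(zigzagLabel_lt_succ hi he).le]

/-- The labels `0, -2, -1, -4, -3, …` decrease between positions at distance at least two. On
neighbours they follow the zigzag order, as does `σ`, so there they give no descent. -/
theorem IsAlternating.zigzagLabel_lt_iff {d : ℕ} {σ : Equiv.Perm (Fin d)} (hσ : IsAlternating σ)
    {a b : Fin d} (h : σ a < σ b) : zigzagLabel b < zigzagLabel a ↔ (a : ℕ) + 1 < b := by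
  have hab : a ≠ b := fun e => h.ne (congrArg σ e)
  have hab' : (a : ℕ) ≠ b := fun e => hab (Fin.ext e)
  have h1 : (b : ℕ) = a + 1 → ¬ Even (a : ℕ) := by
    intro e he
    have := hσ a (by omega)
    rw [if_pos he] at this
    have hb : (⟨a + 1, by omega⟩ : Fin d) = b := Fin.ext e.symm
    rw [hb] at this
    exact lt_asymm h this
  have h2 : (a : ℕ) = b + 1 → Even (b : ℕ) := by
    intro e
    by_contra he
    have := hσ b (by omega)
    rw [if_neg he] at this
    have hb : (⟨b + 1, by omega⟩ : Fin d) = a := Fin.ext e.symm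
    rw [hb] at this
    exact lt_asymm h this
  unfold zigzagLabel
  simp only [Nat.even_iff] at *
  split_ifs <;> omega

theorem swapStat_eq_sum {n : ℕ} (σ : Equiv.Perm (Fin (n + 1))) :
    swapStat σ = ∑ i ∈ range n, if ∃ h : i + 1 < n + 1,
      ((σ.symm ⟨i, by omega⟩ : Fin (n + 1)) : ℕ) + 1 < (σ.symm ⟨i + 1, h⟩ : Fin (n + 1))
      then 1 else 0 := by
  rw [swapStat, card_filter, Fin.sum_univ_castSucc,
    ← Fin.sum_univ_eq_sum_range (fun i => if ∃ h : i + 1 < n + 1,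
      ((σ.symm ⟨i, by omega⟩ : Fin (n + 1)) : ℕ) + 1 < (σ.symm ⟨i + 1, h⟩ : Fin (n + 1))
      then 1 else 0)]
  simp
  rfl

theorem swapStat_le {n : ℕ} (σ : Equiv.Perm (Fin (n + 1))) : swapStat σ ≤ n := by
  rw [swapStat_eq_sum]
  refine (sum_le_sum (g := fun _ => 1) fun i _ => by split_ifs <;> simp).trans (by simp)

theorem swapStat_lt {n : ℕ} (hn : 0 < n) (σ : Equiv.Perm (Fin (n + 1))) : swapStat σ < n := by
  refine lt_of_le_of_ne (swapStat_le σ) fun heq => ?_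
  have key : ∀ i ∈ range n, ∃ h : i + 1 < n + 1,
      ((σ.symm ⟨i, by omega⟩ : Fin (n + 1)) : ℕ) + 1 < (σ.symm ⟨i + 1, h⟩ : Fin (n + 1)) := by
    by_contra! hcon
    obtain ⟨i, hi, hcon⟩ := hcon
    have : swapStat σ < ∑ _i ∈ range n, 1 := by
      rw [swapStat_eq_sum]
      refine sum_lt_sum (fun i _ => by split_ifs <;> simp) ⟨i, hi, ?_⟩
      rw [if_neg (by push Not; exact hcon)]
      exact one_pos
    simp [heq] at this
  -- If every value were a swap, each would lie at least two places after the previous one, and the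
  -- last would be at position `2 n > n`.
  have grow : ∀ i (h : i < n + 1), 2 * i ≤ (σ.symm ⟨i, h⟩ : Fin (n + 1)) := by
    intro i
    induction i with
    | zero => simp
    | succ i ih =>
      intro h
      have h1 := ih (by omega)
      obtain ⟨_, h2⟩ := key i (by simpa using h)
      omega
  have := grow n (by omega)
  have := (σ.symm ⟨n, by omega⟩).isLt
  omega

theorem IsAlternating.sum_descentIndicator {n : ℕ} {σ : Equiv.Perm (Fin (n + 1))}
    (hσ : IsAlternating σ) : ∑ i ∈ range n, descentIndicator zigzagLabel σ i = swapStat σ := by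
  rw [swapStat_eq_sum]
  refine sum_congr rfl fun i hi => ?_
  rw [descentIndicator]
  refine if_congr (exists_congr fun h => hσ.zigzagLabel_lt_iff ?_) rfl rfl
  simp

/-- Negating the labels exchanges descents and ascents. -/
theorem IsAlternating.sum_descentIndicator_neg {n : ℕ} {σ : Equiv.Perm (Fin (n + 1))}
    (hσ : IsAlternating σ) :
    ∑ i ∈ range n, descentIndicator (fun j => -zigzagLabel j) σ i + swapStat σ = n := by
  rw [← hσ.sum_descentIndicator, ← sum_add_distrib]
  trans ∑ i ∈ range n, 1
  · refine sum_congr rfl fun i hi => ?_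
    have hi' : i + 1 < n + 1 := by simpa using hi
    have hne : zigzagLabel (σ.symm ⟨i, by omega⟩) ≠ zigzagLabel (σ.symm ⟨i + 1, hi'⟩) := fun h => by
      simpa using σ.symm.injective (zigzagLabel_injective h)
    simp only [descentIndicator, hi', exists_true_left, neg_lt_neg_iff]
    rcases hne.lt_or_gt with h | h
    · rw [if_pos h, if_neg h.asymm]
    · rw [if_neg h.asymm, if_pos h]
  · simp

open scoped Classical in
theorem card_isWeakZigzag (n k : ℕ) :
    #{f ∈ Fintype.piFinset fun _ : Fin (n + 1) => range (k + 1) | IsWeakZigzag f} =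
      ∑ σ : Equiv.Perm (Fin (n + 1)) with IsAlternating σ,
        (k + 1 + n - swapStat σ).choose (n + 1) := by
  rw [card_words_eq_sum_choose zigzagLabel_injective _ _ _
    fun f σ h => isWeakZigzag_iff_isAlternating h]
  refine sum_congr (by ext; simp) fun σ hσ => ?_
  rw [(mem_filter.1 hσ).2.sum_descentIndicator, Nat.add_sub_assoc (swapStat_le σ)]

open scoped Classical in
theorem card_isStrictZigzag (n k : ℕ) :
    #{f ∈ Fintype.piFinset fun _ : Fin (n + 1) => range (k + 1) | IsStrictZigzag f} =
      ∑ σ : Equiv.Perm (Fin (n + 1)) with IsAlternating σ,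
        (k + 1 + swapStat σ).choose (n + 1) := by
  rw [card_words_eq_sum_choose (fun i j h => zigzagLabel_injective (neg_injective h)) _ _ _
    fun f σ h => isStrictZigzag_iff_isAlternating h]
  refine sum_congr (by ext; simp) fun σ hσ => ?_
  have := (mem_filter.1 hσ).2.sum_descentIndicator_neg
  congr 2
  omega

-- The bijection lowers the letters at even positions by one. These are the peaks: they are
-- positive, and the letters at odd positions are at most `k`. For a single letter the two counts
-- differ, hence `0 < n`.
open scoped Classical in
theorem card_isStrictZigzag_succ {n : ℕ} (hn : 0 < n) (k : ℕ) :
    #{f ∈ Fintype.piFinset fun _ : Fin (n + 1) => range (k + 2) | IsStrictZigzag f} =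
      #{f ∈ Fintype.piFinset fun _ : Fin (n + 1) => range (k + 1) | IsWeakZigzag f} := by
  have hpos : ∀ f : Fin (n + 1) → ℕ, IsStrictZigzag f → ∀ i : Fin (n + 1), Even (i : ℕ) → 0 < f i := by
    intro f hf i hi
    by_cases h : (i : ℕ) + 1 < n + 1
    · have := hf i h
      rw [if_pos hi] at this
      omega
    · have hi0 : (i : ℕ) ≠ 0 := by omega
      have := hf ⟨i - 1, by omega⟩ (by simp; omega)
      have e : (⟨(i : ℕ) - 1 + 1, by omega⟩ : Fin (n + 1)) = i := Fin.ext (by simp; omega)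
      rw [if_neg (by simp only [Nat.even_iff] at *; omega)] at this
      simp only [e] at this
      omega
  have hle : ∀ f : Fin (n + 1) → ℕ, (∀ i, f i < k + 2) → IsStrictZigzag f →
      ∀ i : Fin (n + 1), ¬ Even (i : ℕ) → f i < k + 1 := by
    intro f hk hf i hi
    have hi0 : (i : ℕ) ≠ 0 := by rintro h; simp [h] at hi
    have := hf ⟨i - 1, by omega⟩ (by simp; omega)
    have e : (⟨(i : ℕ) - 1 + 1, by omega⟩ : Fin (n + 1)) = i := Fin.ext (by simp; omega)
    rw [if_pos (by simp only [Nat.even_iff] at *; omega)] at this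
    simp only [e] at this
    have := hk ⟨i - 1, by omega⟩
    omega
  refine card_bij' (fun f _ i => if Even (i : ℕ) then f i - 1 else f i)
    (fun f _ i => if Even (i : ℕ) then f i + 1 else f i) ?_ ?_ ?_ ?_
  · intro f hf
    simp only [mem_filter, Fintype.mem_piFinset, mem_range] at hf ⊢
    refine ⟨fun i => ?_, fun i h => ?_⟩
    · have := hf.1 i
      have := hle f hf.1 hf.2 i
      split_ifs with hi
      · omega
      · exact this hi
    · have h1 := hf.2 i h
      have h2 := hpos f hf.2 i
      have h3 := hpos f hf.2 ⟨i + 1, h⟩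
      simp only [Nat.even_iff] at *
      split_ifs at * <;> omega
  · intro f hf
    simp only [mem_filter, Fintype.mem_piFinset, mem_range] at hf ⊢
    refine ⟨fun i => ?_, fun i h => ?_⟩
    · have := hf.1 i
      split_ifs <;> omega
    · have h1 := hf.2 i h
      simp only [Nat.even_iff] at *
      split_ifs at * <;> omega
  · intro f hf
    simp only [mem_filter, Fintype.mem_piFinset, mem_range] at hf
    funext i
    have := hpos f hf.2 i
    dsimp only
    split_ifs with h
    · have := this h
      omega
    · rfl
  · intro f hf
    funext i
    dsimp only
    split_ifs <;> rfl

/-! ### Integer points of the dilated polytope -/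

/-- The words with `x_i + x_{i + 1} ≤ k` correspond to the weakly alternating words. -/
theorem card_isWeakZigzag_eq_card_chainWords (d k : ℕ) [DecidablePred (@IsWeakZigzag d)] :
    #{f ∈ Fintype.piFinset fun _ : Fin d => range (k + 1) | IsWeakZigzag f} =
      #(chainWords (fun _ a b => a + b ≤ k) (k + 1) d) := by
  refine card_bij' (fun f _ i => if Even (i : ℕ) then k - f i else f i)
    (fun f _ i => if Even (i : ℕ) then k - f i else f i) ?_ ?_ ?_ ?_
  · intro f hf
    simp only [mem_filter, Fintype.mem_piFinset, mem_range, mem_chainWords] at hf ⊢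
    refine ⟨fun i => ?_, fun i h => ?_⟩
    · have := hf.1 i
      split_ifs <;> omega
    · have h1 := hf.2 i h
      have h2 := hf.1 i
      have h3 := hf.1 ⟨i + 1, h⟩
      simp only [Nat.even_iff] at *
      split_ifs at * <;> omega
  · intro f hf
    simp only [mem_filter, Fintype.mem_piFinset, mem_range, mem_chainWords] at hf ⊢
    refine ⟨fun i => ?_, fun i h => ?_⟩
    · have := hf.1 i
      split_ifs <;> omega
    · have h1 := hf.2 i h
      have h2 := hf.1 i
      have h3 := hf.1 ⟨i + 1, h⟩
      simp only [Nat.even_iff] at *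
      split_ifs at * <;> omega
  all_goals
    intro f hf
    simp only [mem_filter, Fintype.mem_piFinset, mem_range, mem_chainWords] at hf
    funext i
    have := hf.1 i
    dsimp only
    split_ifs <;> omega

theorem mem_integerPoints_smul_fibonacciPolytope {d k : ℕ} {z : Fin d → ℤ} :
    z ∈ integerPoints ((k : ℝ) • fibonacciPolytope d) ↔
      (∀ i, 0 ≤ z i ∧ z i ≤ k) ∧ ∀ (i : Fin d) (h : (i : ℕ) + 1 < d), z i + z ⟨i + 1, h⟩ ≤ k := by
  simp only [integerPoints, Set.mem_ofPred_eq, Set.mem_smul_set, fibonacciPolytope, Set.mem_Icc]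
  constructor
  · rintro ⟨x, ⟨hx, hx'⟩, he⟩
    have he' : ∀ i, (k : ℝ) * x i = z i := fun i => congrFun he i
    have hk : (0 : ℝ) ≤ k := Nat.cast_nonneg k
    refine ⟨fun i => ⟨?_, ?_⟩, fun i h => ?_⟩
    · have := mul_nonneg hk (hx i).1
      rw [he'] at this
      exact_mod_cast this
    · have := mul_le_mul_of_nonneg_left (hx i).2 hk
      rw [he', mul_one] at this
      exact_mod_cast this
    · have := mul_le_mul_of_nonneg_left (hx' i h) hk
      rw [mul_add, he', he', mul_one] at this
      exact_mod_cast this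
  · rintro ⟨h1, h2⟩
    have hk : (0 : ℝ) ≤ k := Nat.cast_nonneg k
    -- For `k = 0` division gives the origin, a point of the polytope, and the bounds force `z = 0`.
    refine ⟨fun i => (z i : ℝ) / k, ⟨fun i => ⟨?_, ?_⟩, fun i h => ?_⟩, ?_⟩
    · exact div_nonneg (by exact_mod_cast (h1 i).1) hk
    · exact div_le_one_of_le₀ (by exact_mod_cast (h1 i).2) hk
    · rw [← add_div]
      exact div_le_one_of_le₀ (by exact_mod_cast h2 i h) hk
    · funext i
      rcases Nat.eq_zero_or_pos k with rfl | hk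
      · have := h1 i
        simp only [Pi.smul_apply, smul_eq_mul]
        have : z i = 0 := by simp at this; omega
        simp [this]
      · simp only [Pi.smul_apply, smul_eq_mul]
        field_simp

theorem ncard_integerPoints_smul_fibonacciPolytope (d k : ℕ) :
    (integerPoints ((k : ℝ) • fibonacciPolytope d)).ncard =
      #(chainWords (fun _ a b => a + b ≤ k) (k + 1) d) := by
  rw [← Set.ncard_coe_finset]
  refine (Set.ncard_congr (fun f _ i => (f i : ℤ)) ?_ ?_ ?_).symm
  · intro f hf
    rw [mem_coe, mem_chainWords] at hf
    rw [mem_integerPoints_smul_fibonacciPolytope]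
    refine ⟨fun i => ⟨by positivity, ?_⟩, fun i h => ?_⟩
    · have := hf.1 i
      omega
    · have := hf.2 i h
      omega
  · intro f g _ _ h
    funext i
    exact_mod_cast congrFun h i
  · intro z hz
    rw [mem_integerPoints_smul_fibonacciPolytope] at hz
    refine ⟨fun i => (z i).toNat, ?_, ?_⟩
    · rw [mem_coe, mem_chainWords]
      refine ⟨fun i => ?_, fun i h => ?_⟩
      · have := hz.1 i
        omega
      · have := hz.2 i h
        have := hz.1 i
        have := hz.1 ⟨i + 1, h⟩
        omega
    · funext i
      exact Int.toNat_of_nonneg (hz.1 i).1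

/-! ### Zigzag polynomials and the series `sec + tan` -/

theorem Polynomial.exists_derivative_eq (p : ℚ[X]) :
    ∃ q : ℚ[X], derivative q = p ∧ q.coeff 0 = 0 := by
  induction p using Polynomial.induction_on' with
  | add p q hp hq =>
    obtain ⟨p', hp, hp0⟩ := hp
    obtain ⟨q', hq, hq0⟩ := hq
    exact ⟨p' + q', by simp [hp, hq], by simp [hp0, hq0]⟩
  | monomial n a =>
    refine ⟨monomial (n + 1) (a / (n + 1)), ?_, by simp [coeff_monomial]⟩
    rw [derivative_monomial]
    have : (n : ℚ) + 1 ≠ 0 := by positivity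
    simp [div_mul_cancel₀ _ this]

/-- The polynomials `p_0 = 1`, `p_{d+1}(x) = ∫_0^x p_d(1 - s) ds`, whose values at `1` are the
volumes of the zigzag order polytopes. -/
noncomputable def zigzagPoly : ℕ → ℚ[X]
  | 0 => 1
  | d + 1 => (exists_derivative_eq ((zigzagPoly d).comp (1 - X))).choose

theorem derivative_zigzagPoly_succ (d : ℕ) :
    derivative (zigzagPoly (d + 1)) = (zigzagPoly d).comp (1 - X) :=
  (exists_derivative_eq ((zigzagPoly d).comp (1 - X))).choose_spec.1

theorem coeff_zero_zigzagPoly_succ (d : ℕ) : (zigzagPoly (d + 1)).coeff 0 = 0 :=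
  (exists_derivative_eq ((zigzagPoly d).comp (1 - X))).choose_spec.2

theorem derivative_derivative_zigzagPoly (d : ℕ) :
    derivative (derivative (zigzagPoly (d + 2))) = -zigzagPoly d := by
  rw [derivative_zigzagPoly_succ, derivative_comp, derivative_zigzagPoly_succ, comp_assoc]
  simp

/-- Coefficient form of `∑ p_d(x) t^d = E(t) sin(t x) + cos(t x)` with `E(t) = ∑ p_d(1) t^d`. The
equation `p_{d+2}'' = -p_d` gives the recursion of sine and cosine; the initial data are `p_{d+1}(0)
= 0` and `p_{d+1}'(0) = p_d(1)`. -/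
theorem coeff_zigzagPoly (j d : ℕ) : (zigzagPoly d).coeff j =
    if j ≤ d then PowerSeries.coeff j (PowerSeries.sin ℚ) * (zigzagPoly (d - j)).eval 1 +
      (if j = d then PowerSeries.coeff j (PowerSeries.cos ℚ) else 0) else 0 := by
  induction j using Nat.twoStepInduction generalizing d with
  | zero =>
    rcases d with - | d
    · simp [zigzagPoly, PowerSeries.sin, PowerSeries.cos]
    · simp [coeff_zero_zigzagPoly_succ, PowerSeries.sin]
  | one =>
    rcases d with - | d
    · simp [zigzagPoly, coeff_one]
    · have h := coeff_derivative (zigzagPoly (d + 1)) 0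
      rw [derivative_zigzagPoly_succ, coeff_zero_eq_eval_zero, eval_comp] at h
      simp at h
      simp [← h, PowerSeries.sin, PowerSeries.cos]
  | more j ih _ =>
    rcases d with - | - | d
    · simp [zigzagPoly, coeff_one]
    · have h := coeff_derivative (zigzagPoly 1) (j + 1)
      rw [derivative_zigzagPoly_succ] at h
      have h' : (j : ℚ) + 1 + 1 ≠ 0 := by positivity
      simpa [zigzagPoly, coeff_one, h'] using h
    · have h := congrArg (fun p => p.coeff j) (derivative_derivative_zigzagPoly d)
      have h1 : (j : ℚ) + 1 ≠ 0 := by positivity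
      have h2 : (j : ℚ) + 1 + 1 ≠ 0 := by positivity
      simp only [coeff_derivative, coeff_neg, ih d] at h
      push_cast at h
      have hs : PowerSeries.coeff (j + 2) (PowerSeries.sin ℚ) * (j + 1 + 1) * (j + 1) =
          -PowerSeries.coeff j (PowerSeries.sin ℚ) := by
        simp only [PowerSeries.sin, PowerSeries.coeff_mk, Nat.even_add, even_two, iff_true]
        split_ifs
        · simp
        · have := Nat.factorial_ne_zero j
          simp [Nat.factorial_succ, pow_succ]
          field_simp
      have hc : PowerSeries.coeff (j + 2) (PowerSeries.cos ℚ) * (j + 1 + 1) * (j + 1) =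
          -PowerSeries.coeff j (PowerSeries.cos ℚ) := by
        simp only [PowerSeries.cos, PowerSeries.coeff_mk, Nat.even_add, even_two, iff_true]
        split_ifs
        · have := Nat.factorial_ne_zero j
          simp [Nat.factorial_succ, pow_succ]
          field_simp
        · simp
      refine mul_right_cancel₀ h2 (mul_right_cancel₀ h1 (h.trans ?_))
      simp only [Nat.add_le_add_iff_right, Nat.add_sub_add_right, Nat.add_right_cancel_iff]
      split_ifs
      · linear_combination (-(zigzagPoly (d - j)).eval 1) * hs - hc
      · linear_combination (-(zigzagPoly (d - j)).eval 1) * hs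
      · simp

theorem natDegree_zigzagPoly_le (d : ℕ) : (zigzagPoly d).natDegree ≤ d := by
  rw [natDegree_le_iff_coeff_eq_zero]
  intro j hj
  rw [coeff_zigzagPoly, if_neg (by omega)]

theorem PowerSeries.derivative_sin : derivative ℚ (PowerSeries.sin ℚ) = PowerSeries.cos ℚ := by
  ext n
  rw [PowerSeries.coeff_derivative]
  simp only [PowerSeries.sin, PowerSeries.cos, PowerSeries.coeff_mk, Nat.even_add_one]
  have := Nat.factorial_ne_zero n
  split_ifs with h
  · rw [Nat.succ_div_of_not_dvd (by rw [← even_iff_two_dvd, Nat.even_add_one]; exact not_not.2 h)]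
    simp [Nat.factorial_succ]
    field_simp
  · simp

theorem PowerSeries.derivative_cos : derivative ℚ (PowerSeries.cos ℚ) = -PowerSeries.sin ℚ := by
  ext n
  rw [PowerSeries.coeff_derivative]
  simp only [PowerSeries.sin, PowerSeries.cos, PowerSeries.coeff_mk, Nat.even_add_one, map_neg]
  have := Nat.factorial_ne_zero n
  split_ifs with h
  · simp
  · rw [Nat.succ_div_of_dvd (by rw [← even_iff_two_dvd, Nat.even_add_one]; exact h)]
    simp [Nat.factorial_succ, pow_succ]
    field_simp

theorem PowerSeries.constantCoeff_sin :
    PowerSeries.constantCoeff (PowerSeries.sin ℚ) = 0 := by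
  rw [← PowerSeries.coeff_zero_eq_constantCoeff_apply, PowerSeries.sin, PowerSeries.coeff_mk]
  simp

theorem PowerSeries.constantCoeff_cos :
    PowerSeries.constantCoeff (PowerSeries.cos ℚ) = 1 := by
  rw [← PowerSeries.coeff_zero_eq_constantCoeff_apply, PowerSeries.cos, PowerSeries.coeff_mk]
  simp

theorem PowerSeries.sin_sq_add_cos_sq :
    PowerSeries.sin ℚ ^ 2 + PowerSeries.cos ℚ ^ 2 = 1 := by
  refine PowerSeries.derivative.ext (R := ℚ) ?_ ?_
  · simp [pow_two, derivative_sin, derivative_cos]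
    ring
  · simp [PowerSeries.constantCoeff_sin, PowerSeries.constantCoeff_cos]

/-- Setting `x = 1` gives `E = E sin + cos`. Both sides become `cos` after multiplication by `1 -
sin`, which is nonzero. -/
theorem mk_eval_one_zigzagPoly :
    PowerSeries.mk (fun d => (zigzagPoly d).eval 1) =
      (PowerSeries.cos ℚ)⁻¹ + PowerSeries.sin ℚ * (PowerSeries.cos ℚ)⁻¹ := by
  set E := PowerSeries.mk (fun d => (zigzagPoly d).eval 1) with hE
  have h1 : E = PowerSeries.sin ℚ * E + PowerSeries.cos ℚ := by
    ext d
    rw [map_add, PowerSeries.coeff_mul, Finset.Nat.sum_antidiagonal_eq_sum_range_succ_mk, hE,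
      PowerSeries.coeff_mk, eval_eq_sum_range' (Nat.lt_succ_of_le (natDegree_zigzagPoly_le d))]
    simp only [one_pow, mul_one, PowerSeries.coeff_mk]
    rw [sum_congr rfl fun j hj => (coeff_zigzagPoly j d).trans
      (if_pos (Nat.lt_succ_iff.1 (mem_range.1 hj))), sum_add_distrib]
    simp
  have hc : PowerSeries.cos ℚ * (PowerSeries.cos ℚ)⁻¹ = 1 := by
    refine PowerSeries.mul_inv_cancel _ ?_
    simp [PowerSeries.constantCoeff_cos]
  have hne : (1 : PowerSeries ℚ) - PowerSeries.sin ℚ ≠ 0 := by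
    intro h
    have := congrArg (PowerSeries.coeff 0) h
    simp [PowerSeries.sin] at this
  refine mul_right_cancel₀ hne ?_
  linear_combination h1 + (PowerSeries.cos ℚ)⁻¹ * PowerSeries.sin_sq_add_cos_sq
    - PowerSeries.cos ℚ * hc

theorem eval_one_zigzagPoly (d : ℕ) :
    (zigzagPoly d).eval 1 = eulerZigzag d / d.factorial := by
  have := Nat.factorial_ne_zero d
  rw [eulerZigzag, ← mk_eval_one_zigzagPoly, PowerSeries.coeff_mk]
  field_simp

/-! ### Asymptotics of the number of words -/

theorem Polynomial.exists_abs_eval_le (q : ℚ[X]) :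
    ∃ B, 0 ≤ B ∧ ∀ x, 0 ≤ x → x ≤ 1 → |q.eval x| ≤ B := by
  induction q using Polynomial.induction_on' with
  | add p q hp hq =>
    obtain ⟨A, hA, hp⟩ := hp
    obtain ⟨B, hB, hq⟩ := hq
    refine ⟨A + B, by positivity, fun x h0 h1 => ?_⟩
    rw [eval_add]
    exact (abs_add_le _ _).trans (add_le_add (hp x h0 h1) (hq x h0 h1))
  | monomial n a =>
    refine ⟨|a|, abs_nonneg a, fun x h0 h1 => ?_⟩
    rw [eval_monomial, abs_mul, abs_of_nonneg (pow_nonneg h0 n)]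
    exact mul_le_of_le_one_right (abs_nonneg a) (pow_le_one₀ h0 h1)

/-- A uniform second-order Taylor bound over `ℚ`. Multiplying `q` by `X` multiplies the remainder by
`x + h ≤ 2` and adds `h ^ 2 * q'(x)`. -/
theorem Polynomial.exists_abs_eval_add_sub_le (q : ℚ[X]) :
    ∃ T, 0 ≤ T ∧ ∀ x h, 0 ≤ x → x ≤ 1 → 0 ≤ h → h ≤ 1 →
      |q.eval (x + h) - q.eval x - h * (derivative q).eval x| ≤ T * h ^ 2 := by
  induction q using Polynomial.induction_on with
  | C a => exact ⟨0, le_rfl, by simp⟩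
  | add p q hp hq =>
    obtain ⟨A, hA, hp⟩ := hp
    obtain ⟨B, hB, hq⟩ := hq
    refine ⟨A + B, by positivity, fun x h h0 h1 h2 h3 => ?_⟩
    have := (abs_add_le _ _).trans (add_le_add (hp x h h0 h1 h2 h3) (hq x h h0 h1 h2 h3))
    refine (le_of_eq ?_).trans (this.trans (le_of_eq (by ring)))
    congr 1
    simp only [derivative_add, eval_add]
    ring
  | monomial n a ih =>
    obtain ⟨A, hA, ih⟩ := ih
    rw [pow_succ, ← mul_assoc]
    generalize C a * X ^ n = q at ih ⊢
    obtain ⟨B, hB, hb⟩ := exists_abs_eval_le (derivative q)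
    refine ⟨2 * A + B, by positivity, fun x h h0 h1 h2 h3 => ?_⟩
    have e : (q * X).eval (x + h) - (q * X).eval x - h * (derivative (q * X)).eval x =
        (x + h) * (q.eval (x + h) - q.eval x - h * (derivative q).eval x) +
          h ^ 2 * (derivative q).eval x := by
      simp
      ring
    rw [e]
    refine (abs_add_le _ _).trans ?_
    rw [abs_mul, abs_mul, abs_of_nonneg (add_nonneg h0 h2), abs_of_nonneg (sq_nonneg h)]
    have i1 : (x + h) * |q.eval (x + h) - q.eval x - h * (derivative q).eval x| ≤
        2 * (A * h ^ 2) :=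
      mul_le_mul (by linarith) (ih x h h0 h1 h2 h3) (abs_nonneg _) (by norm_num)
    have i2 : h ^ 2 * |(derivative q).eval x| ≤ h ^ 2 * B :=
      mul_le_mul_of_nonneg_left (hb x h0 h1) (sq_nonneg h)
    linarith

theorem chainCount_add_le_succ {k b : ℕ} (d : ℕ) (hb : b ≤ k) :
    chainCount (fun _ a b => a + b ≤ k) (k + 1) (d + 1) b =
      ∑ a ∈ range (k - b + 1), chainCount (fun _ a b => a + b ≤ k) (k + 1) d a := by
  rw [chainCount_succ _ _ (by omega)]
  refine sum_congr ?_ fun _ _ => rfl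
  ext a
  simp only [mem_filter, mem_range]
  omega

/-- The number of words with `x_i + x_{i + 1} ≤ k` and given last letter is, up to a term of lower
order in `k`, given by the zigzag polynomials. -/
theorem exists_abs_chainCount_sub_le (d : ℕ) :
    ∃ A : ℚ, 0 ≤ A ∧ ∀ k : ℕ, 0 < k → ∀ b ≤ k,
      |(chainCount (fun _ a b => a + b ≤ k) (k + 1) d b : ℚ) -
        k ^ d * (zigzagPoly d).eval (1 - b / k : ℚ)| ≤ A * k ^ d / k := by
  induction d with
  | zero =>
    refine ⟨0, le_rfl, fun k hk b hb => ?_⟩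
    rw [chainCount_zero _ (by omega)]
    simp [zigzagPoly]
  | succ d ih =>
    obtain ⟨A, hA, ih⟩ := ih
    obtain ⟨B, hB, hb⟩ := exists_abs_eval_le (zigzagPoly d)
    obtain ⟨T, hT, ht⟩ := exists_abs_eval_add_sub_le (zigzagPoly (d + 1))
    -- `A + T` bounds the inductive and Taylor errors over at most `k` summands; `A + B` bounds the
    -- one summand `a = k - b` outside the telescoping sum.
    refine ⟨A + T + (A + B), by positivity, fun k hk b hbk => ?_⟩
    have hk' : (0 : ℚ) < k := by exact_mod_cast hk
    have hk1 : (1 : ℚ) ≤ k := by exact_mod_cast hk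
    rw [chainCount_add_le_succ d hbk]
    obtain ⟨m, rfl⟩ : ∃ m, k = b + m := ⟨k - b, by omega⟩
    rw [show b + m - b = m by omega]
    set k := b + m with hkdef
    have hx : (1 : ℚ) - b / k = m / k := by
      field_simp
      rw [hkdef]
      push_cast
      ring
    set N : ℕ → ℚ := fun a => (chainCount (fun _ a b => a + b ≤ k) (k + 1) d a : ℚ) with hN
    -- Since `p_{d+1}'(a / k) = p_d(1 - a / k)`, the summand is close to an increment of `p_{d+1}`
    -- over a step `1 / k`, and the increments telescope.
    have hterm : ∀ a ∈ range m, |N a - k ^ (d + 1) * ((zigzagPoly (d + 1)).eval ((a + 1 : ℕ) / k : ℚ)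
        - (zigzagPoly (d + 1)).eval (a / k : ℚ))| ≤ (A + T) * k ^ d / k := by
      intro a ha
      have ham : a < m := mem_range.1 ha
      have ha1 : (a : ℚ) / k ≤ 1 := div_le_one_of_le₀ (by exact_mod_cast (by omega)) hk'.le
      have i1 := ih k hk a (by omega)
      have i2 := ht (a / k) (1 / k) (by positivity) ha1 (by positivity)
        (div_le_one_of_le₀ hk1 hk'.le)
      rw [derivative_zigzagPoly_succ, eval_comp, ← add_div] at i2
      simp only [eval_sub, eval_one, eval_X] at i2
      have i3 := mul_le_mul_of_nonneg_left i2 (pow_nonneg hk'.le (d + 1))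
      rw [← abs_of_nonneg (pow_nonneg hk'.le (d + 1)), ← abs_mul,
        abs_of_nonneg (pow_nonneg hk'.le (d + 1))] at i3
      refine (le_of_eq ?_).trans ((abs_sub _ _).trans (add_le_add i1 i3) |>.trans (le_of_eq ?_))
      · congr 1
        simp only [hN]
        push_cast
        field_simp
        ring
      · field_simp
        ring
    have hlast : |N m| ≤ (A + B) * k ^ d := by
      have hm1 : (m : ℚ) / k ≤ 1 := div_le_one_of_le₀ (by exact_mod_cast (by omega)) hk'.le
      have i1 := ih k hk m (by omega)
      have i2 := mul_le_mul_of_nonneg_left (hb (1 - m / k) (by linarith)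
        (by have : (0 : ℚ) ≤ m / k := by positivity
            linarith)) (pow_nonneg hk'.le d)
      rw [← abs_of_nonneg (pow_nonneg hk'.le d), ← abs_mul,
        abs_of_nonneg (pow_nonneg hk'.le d)] at i2
      have i3 : A * k ^ d / k ≤ A * k ^ d := div_le_self (by positivity) hk1
      have i4 := abs_add_le (N m - k ^ d * (zigzagPoly d).eval (1 - m / k : ℚ))
        (k ^ d * (zigzagPoly d).eval (1 - m / k : ℚ) : ℚ)
      rw [sub_add_cancel] at i4
      linarith
    have htel : (zigzagPoly (d + 1)).eval (m / k : ℚ) = ∑ a ∈ range m,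
        ((zigzagPoly (d + 1)).eval ((a + 1 : ℕ) / k : ℚ)
        - (zigzagPoly (d + 1)).eval (a / k : ℚ)) := by
      rw [sum_range_sub fun a : ℕ => (zigzagPoly (d + 1)).eval (a / k : ℚ)]
      simp [← coeff_zero_eq_eval_zero, coeff_zero_zigzagPoly_succ]
    have hsum : |∑ a ∈ range m, (N a - k ^ (d + 1) *
        ((zigzagPoly (d + 1)).eval ((a + 1 : ℕ) / k : ℚ)
        - (zigzagPoly (d + 1)).eval (a / k : ℚ)))| ≤ (A + T) * k ^ d := by
      refine (abs_sum_le_sum_abs _ _).trans ((sum_le_sum hterm).trans ?_)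
      rw [sum_const, card_range, nsmul_eq_mul]
      have hmk : (m : ℚ) ≤ k := by exact_mod_cast (by omega)
      calc (m : ℚ) * ((A + T) * k ^ d / k) ≤ k * ((A + T) * k ^ d / k) := by gcongr
        _ = (A + T) * k ^ d := by field_simp
    rw [hx, htel, sum_range_succ]
    push_cast
    rw [mul_sum]
    rw [sum_sub_distrib] at hsum
    have i4 := (abs_add_le _ _).trans (add_le_add hsum hlast)
    refine (le_of_eq ?_).trans (i4.trans (le_of_eq ?_))
    · congr 1
      push_cast
      ring
    · field_simp
      ring

theorem exists_abs_card_chainWords_sub_le (n : ℕ) :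
    ∃ A : ℚ, ∀ k : ℕ, 0 < k →
      |(#(chainWords (fun _ a b => a + b ≤ k) (k + 1) (n + 1)) : ℚ) -
        eulerZigzag (n + 1) / (n + 1).factorial * k ^ (n + 1)| ≤ A * k ^ (n + 1) / k := by
  obtain ⟨A, -, h⟩ := exists_abs_chainCount_sub_le (n + 1)
  refine ⟨A, fun k hk => ?_⟩
  -- A final letter `0` constrains nothing, so words one letter longer that end in `0` count all
  -- words.
  have := h k hk 0 (Nat.zero_le k)
  rw [chainCount_add_le_succ n (Nat.zero_le k), Nat.sub_zero, ← card_chainWords_succ] at this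
  simpa [eval_one_zigzagPoly, mul_comm] using this

theorem Polynomial.coeff_eq_of_abs_eval_sub_le {P : ℚ[X]} {d : ℕ} (hP : P.natDegree ≤ d) {e A : ℚ}
    (h : ∀ k : ℕ, 0 < k → |P.eval (k : ℚ) - e * k ^ d| ≤ A * k ^ d / k) : P.coeff d = e := by
  have hdeg : (P - C (P.coeff d) * X ^ d).degree < (X ^ d : ℚ[X]).degree := by
    rw [degree_X_pow, degree_lt_iff_coeff_zero]
    intro m hm
    rcases hm.eq_or_lt with rfl | hm
    · simp
    · simp [coeff_eq_zero_of_natDegree_lt (hP.trans_lt hm), coeff_X_pow, hm.ne']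
  have t1 := (div_tendsto_atTop_zero_of_degree_lt _ _ hdeg).comp (tendsto_natCast_atTop_atTop (R := ℚ))
  have t2 : Filter.Tendsto (fun k : ℕ => P.eval (k : ℚ) / k ^ d - e) Filter.atTop (nhds 0) := by
    refine squeeze_zero_norm' (a := fun k : ℕ => ((A / k : ℚ) : ℝ)) ?_ ?_
    · filter_upwards [Filter.eventually_gt_atTop 0] with k hk
      have hk' : (0 : ℚ) < k := by exact_mod_cast hk
      have h1 := h k hk
      have : |P.eval (k : ℚ) / k ^ d - e| ≤ A / k := by
        rw [div_sub' (pow_pos hk' d).ne', abs_div, abs_of_pos (pow_pos hk' d),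
          div_le_iff₀ (pow_pos hk' d), mul_comm _ e]
        refine h1.trans (le_of_eq ?_)
        ring
      rw [← Rat.norm_cast_real, Real.norm_eq_abs]
      exact_mod_cast this
    · push_cast
      exact tendsto_const_div_atTop_nhds_zero_nat _
  have t3 := t1.sub t2
  have t4 : Filter.Tendsto (fun _ : ℕ => e - P.coeff d) Filter.atTop (nhds (0 - 0)) := by
    refine t3.congr' ?_
    filter_upwards [Filter.eventually_gt_atTop 0] with k hk
    have hk' : (k : ℚ) ≠ 0 := by exact_mod_cast hk.ne'
    simp
    field_simp
    ring
  have := tendsto_nhds_unique t4 tendsto_const_nhds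
  linarith

/-! ### Rising factorials and the Ehrhart polynomial -/

/-- The polynomial `(X + c) (X + c + 1) ⋯ (X + c + n - 1)`. -/
noncomputable def risingPoly (n : ℕ) (c : ℚ) : ℚ[X] :=
  ∏ i ∈ range n, (X + C (c + i))

theorem risingPoly_comp_X_sub_C (n : ℕ) (c s : ℚ) :
    (risingPoly n c).comp (X - C s) = risingPoly n (c - s) := by
  rw [risingPoly, risingPoly, Polynomial.prod_comp]
  refine prod_congr rfl fun i _ => ?_
  simp
  ring

theorem natDegree_risingPoly_le (n : ℕ) (c : ℚ) : (risingPoly n c).natDegree ≤ n := by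
  refine (natDegree_prod_le _ _).trans ?_
  simp only [natDegree_X_add_C, sum_const, card_range, smul_eq_mul, mul_one, le_refl]

theorem coeff_risingPoly_succ (n : ℕ) (c : ℚ) (j : ℕ) :
    (risingPoly (n + 1) c).coeff (j + 1) =
      (risingPoly n c).coeff j + (risingPoly n c).coeff (j + 1) * (c + n) := by
  rw [risingPoly, prod_range_succ, ← risingPoly, mul_add, coeff_add, coeff_mul_X, coeff_mul_C]

/-- These are the elementary symmetric functions of degrees `0`, `1`, `2` in `c, c + 1, …, c + n +
1`. -/
theorem coeff_risingPoly (n : ℕ) (c : ℚ) :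
    (risingPoly (n + 2) c).coeff (n + 2) = 1 ∧
    (risingPoly (n + 2) c).coeff (n + 1) = (n + 2) * c + (n + 2) * (n + 1) / 2 ∧
    (risingPoly (n + 2) c).coeff n = (n + 2) * (n + 1) / 2 * c ^ 2 +
      (n + 1) * c * ((n + 2) * (n + 1) / 2) + (n + 2) * (n + 1) * n * (3 * n + 5) / 24 := by
  induction n with
  | zero =>
    have h : risingPoly 2 c = X ^ 2 + C (2 * c + 1) * X + C (c * (c + 1)) := by
      simp only [risingPoly, prod_range_succ, prod_range_zero, one_mul, Nat.cast_zero, Nat.cast_one,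
        C_add, C_mul, C_0, C_1, map_ofNat]
      ring
    simp only [zero_add, h, coeff_add, coeff_X_pow, coeff_C_mul, coeff_X, coeff_C]
    norm_num
    ring
  | succ n ih =>
    obtain ⟨h1, h2, h3⟩ := ih
    refine ⟨?_, ?_, ?_⟩
    · rw [coeff_risingPoly_succ, h1, coeff_eq_zero_of_natDegree_lt, zero_mul, add_zero]
      exact (natDegree_risingPoly_le _ _).trans_lt (by omega)
    · rw [coeff_risingPoly_succ, h1, h2]
      push_cast
      ring
    · rw [coeff_risingPoly_succ, h2, h3]
      push_cast
      ring

/-- The factors are `N, N - 1, …, N - n + 1`. For `N < n` one of them vanishes, so the identity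
needs no lower bound on `N` and the Ehrhart count is polynomial from `k = 0` on. -/
theorem eval_risingPoly_eq_choose {n N : ℕ} {c x : ℚ} (h : x + c + n = N + 1) :
    (risingPoly n c).eval x = n.factorial * N.choose n := by
  rw [← Nat.cast_mul, ← Nat.descFactorial_eq_factorial_mul_choose,
    ← descPochhammer_eval_eq_descFactorial, descPochhammer_eval_eq_prod_range, risingPoly,
    eval_prod, ← prod_range_reflect]
  refine prod_congr rfl fun i hi => ?_
  have hi' : i + 1 ≤ n := mem_range.1 hi
  rw [Nat.sub_sub, add_comm 1 i]
  simp only [eval_add, eval_X, eval_C]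
  push_cast [Nat.cast_sub hi']
  linear_combination h

theorem Polynomial.eq_of_eval_natCast_eq {P Q : ℚ[X]} (h : ∀ k : ℕ, P.eval (k : ℚ) = Q.eval (k : ℚ)) :
    P = Q := by
  refine eq_of_infinite_eval_eq P Q ?_
  refine (Set.infinite_range_of_injective (Nat.cast_injective (R := ℚ))).mono ?_
  rintro _ ⟨k, rfl⟩
  exact h k

/-- The alternating permutations of `d` letters. -/
def alternatingPerms (d : ℕ) : Finset (Equiv.Perm (Fin d)) :=
  {σ | IsAlternating σ}

/-- The shifted Ehrhart polynomial of the Fibonacci polytope. -/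
noncomputable def shiftedEhrhart (d : ℕ) (s : ℚ) : ℚ[X] :=
  C (1 / (d.factorial : ℚ)) * ∑ σ ∈ alternatingPerms d, risingPoly d (1 + s - swapStat σ)

/-- Translation only moves the parameter `s`, so one computation of coefficients serves both
expansions. -/
theorem shiftedEhrhart_comp (d : ℕ) (s t : ℚ) :
    (shiftedEhrhart d s).comp (X - C t) = shiftedEhrhart d (s - t) := by
  simp only [shiftedEhrhart, mul_comp, C_comp, Polynomial.sum_comp, risingPoly_comp_X_sub_C]
  congr 1
  refine sum_congr rfl fun σ _ => ?_
  congr 1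
  ring

theorem natDegree_shiftedEhrhart_le (d : ℕ) (s : ℚ) : (shiftedEhrhart d s).natDegree ≤ d :=
  (natDegree_C_mul_le _ _).trans
    (natDegree_sum_le_of_forall_le _ _ fun _ _ => natDegree_risingPoly_le _ _)

theorem coeff_shiftedEhrhart (d : ℕ) (s : ℚ) (j : ℕ) : (shiftedEhrhart d s).coeff j =
    1 / d.factorial * ∑ σ ∈ alternatingPerms d, (risingPoly d (1 + s - swapStat σ)).coeff j := by
  rw [shiftedEhrhart, coeff_C_mul, finsetSum_coeff]

theorem eval_shiftedEhrhart_zero (n k : ℕ) : (shiftedEhrhart (n + 1) 0).eval (k : ℚ) =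
    #(chainWords (fun _ a b => a + b ≤ k) (k + 1) (n + 1)) := by
  classical
  rw [← card_isWeakZigzag_eq_card_chainWords, card_isWeakZigzag, shiftedEhrhart, eval_mul, eval_C,
    eval_finsetSum, sum_congr rfl fun σ _ => eval_risingPoly_eq_choose
      (N := k + 1 + n - swapStat σ) (by
        push_cast [Nat.cast_sub ((swapStat_le σ).trans (Nat.le_add_left n (k + 1)))]
        ring), ← mul_sum]
  have := Nat.factorial_ne_zero (n + 1)
  push_cast
  field_simp
  rfl

theorem isEhrhartPolynomial_shiftedEhrhart (n : ℕ) :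
    IsEhrhartPolynomial (fibonacciPolytope (n + 1)) (shiftedEhrhart (n + 1) 0) := fun k => by
  rw [ncard_integerPoints_smul_fibonacciPolytope, eval_shiftedEhrhart_zero]

/-! ### Moments of the swap statistic and the top coefficients -/

/-- The zigzag words are their own reciprocals up to a shift, which determines the mean of the swap
statistic. -/
theorem two_mul_sum_swapStat (m : ℕ) :
    2 * ∑ σ ∈ alternatingPerms (m + 2), (swapStat σ : ℚ) = #(alternatingPerms (m + 2)) * m := by
  classical
  have h : ∑ σ ∈ alternatingPerms (m + 2), risingPoly (m + 2) (1 - swapStat σ) =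
      ∑ σ ∈ alternatingPerms (m + 2), risingPoly (m + 2) (1 + swapStat σ - m) := by
    refine Polynomial.eq_of_eval_natCast_eq fun k => ?_
    have e := card_isStrictZigzag_succ (n := m + 1) (by omega) k
    rw [card_isWeakZigzag, card_isStrictZigzag] at e
    rw [eval_finsetSum, eval_finsetSum,
      sum_congr rfl fun σ _ => eval_risingPoly_eq_choose (N := k + 1 + (m + 1) - swapStat σ) (by
        push_cast [Nat.cast_sub ((swapStat_le σ).trans (Nat.le_add_left (m + 1) (k + 1)))]
        ring),
      sum_congr rfl fun σ _ => eval_risingPoly_eq_choose (N := k + 1 + 1 + swapStat σ) (by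
        push_cast
        ring), ← mul_sum, ← mul_sum]
    congr 1
    exact_mod_cast e.symm
  -- The second coefficient is affine in the offset, so the comparison reads `∑ (1 - swap σ) = ∑ (1
  -- + swap σ - m)`.
  have h := congrArg (fun p => p.coeff (m + 1)) h
  simp only [finsetSum_coeff, (coeff_risingPoly m _).2.1] at h
  simp only [mul_sub, mul_add, sum_add_distrib, sum_sub_distrib, ← mul_sum, sum_const,
    nsmul_eq_mul] at h
  have h2 : (m : ℚ) + 2 ≠ 0 := by positivity
  refine mul_left_cancel₀ h2 ?_
  linear_combination -h

/-- Two evaluations of one leading coefficient: the sum over permutations gives their number over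
`d!`, the asymptotics give `E_d / d!`. -/
theorem card_alternatingPerms (n : ℕ) :
    (#(alternatingPerms (n + 2)) : ℚ) = eulerZigzag (n + 2) := by
  obtain ⟨A, hA⟩ := exists_abs_card_chainWords_sub_le (n + 1)
  have h := coeff_eq_of_abs_eval_sub_le (natDegree_shiftedEhrhart_le (n + 2) 0)
    (e := eulerZigzag (n + 2) / (n + 2).factorial) (A := A) fun k hk => by
      rw [eval_shiftedEhrhart_zero]
      exact hA k hk
  simp only [coeff_shiftedEhrhart, (coeff_risingPoly n _).1, sum_const, nsmul_eq_mul, mul_one] at h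
  have := Nat.factorial_ne_zero (n + 2)
  field_simp at h
  exact h

theorem sum_choose_two_swapStat (m : ℕ) :
    ∑ σ ∈ alternatingPerms (m + 2), ((swapStat σ).choose 2 : ℚ) =
      ∑ j ∈ range (m + 1), (j.choose 2 : ℚ) * (swapCount (m + 2) j : ℚ) := by
  rw [← sum_fiberwise_of_maps_to (g := swapStat) (t := range (m + 1))
    fun σ _ => mem_range.2 (swapStat_lt m.succ_pos σ)]
  refine sum_congr rfl fun j _ => ?_
  rw [sum_congr rfl fun σ hσ => by rw [(mem_filter.1 hσ).2], sum_const, nsmul_eq_mul, mul_comm,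
    swapCount, alternatingPerms, filter_filter]

theorem coeff_shiftedEhrhart_top (m : ℕ) (s : ℚ) :
    (shiftedEhrhart (m + 2) s).coeff (m + 2) = eulerZigzag (m + 2) / (m + 2).factorial ∧
    (shiftedEhrhart (m + 2) s).coeff (m + 1) =
      (s + 3 / 2) * (eulerZigzag (m + 2) / (m + 1).factorial) ∧
    (shiftedEhrhart (m + 2) s).coeff m = 1 / m.factorial *
      (eulerZigzag (m + 2) * ((-3 * ((m : ℚ) + 2) ^ 2 + 17 * ((m : ℚ) + 2) + 2) / 24
        + s * (s + 3) / 2) +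
        ∑ j ∈ range (m + 1), (j.choose 2 : ℚ) * (swapCount (m + 2) j : ℚ)) := by
  have h1 := two_mul_sum_swapStat m
  rw [card_alternatingPerms] at h1
  have h3 : ∑ σ ∈ alternatingPerms (m + 2), (swapStat σ : ℚ) ^ 2 =
      2 * ∑ j ∈ range (m + 1), (j.choose 2 : ℚ) * (swapCount (m + 2) j : ℚ) +
        ∑ σ ∈ alternatingPerms (m + 2), (swapStat σ : ℚ) := by
    rw [← sum_choose_two_swapStat, mul_sum, ← sum_add_distrib]
    refine sum_congr rfl fun σ _ => ?_
    rw [Nat.cast_choose_two]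
    ring
  have hf := Nat.factorial_ne_zero m
  set S := ∑ j ∈ range (m + 1), (j.choose 2 : ℚ) * (swapCount (m + 2) j : ℚ)
  refine ⟨?_, ?_, ?_⟩
  · simp only [coeff_shiftedEhrhart, (coeff_risingPoly m _).1, sum_const, nsmul_eq_mul, mul_one,
      card_alternatingPerms]
    ring
  · simp only [coeff_shiftedEhrhart, (coeff_risingPoly m _).2.1]
    have : ∑ σ ∈ alternatingPerms (m + 2), (((m : ℚ) + 2) * (1 + s - swapStat σ) +
        (m + 2) * (m + 1) / 2) = (s + 3 / 2) * (m + 2) * eulerZigzag (m + 2) := by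
      simp only [mul_sub, sum_add_distrib, sum_sub_distrib, ← mul_sum, sum_const, nsmul_eq_mul,
        card_alternatingPerms]
      linear_combination (-((m : ℚ) + 2) / 2) * h1
    rw [this, Nat.factorial_succ (m + 1)]
    have := Nat.factorial_ne_zero (m + 1)
    push_cast
    field_simp
    ring
  · simp only [coeff_shiftedEhrhart, (coeff_risingPoly m _).2.2]
    have : ∑ σ ∈ alternatingPerms (m + 2), (((m : ℚ) + 2) * (m + 1) / 2 * (1 + s - swapStat σ) ^ 2 +
        (m + 1) * (1 + s - swapStat σ) * ((m + 2) * (m + 1) / 2) +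
        (m + 2) * (m + 1) * m * (3 * m + 5) / 24) = (m + 2) * (m + 1) *
        (eulerZigzag (m + 2) * ((-3 * ((m : ℚ) + 2) ^ 2 + 17 * ((m : ℚ) + 2) + 2) / 24
        + s * (s + 3) / 2) + S) := by
      -- Sorted by powers of `x = swap σ`, the sum needs only the moments supplied by `h3`, `h1` and
      -- `card_alternatingPerms`.
      have e : ∀ x : ℚ, ((m : ℚ) + 2) * (m + 1) / 2 * (1 + s - x) ^ 2 +
          (m + 1) * (1 + s - x) * ((m + 2) * (m + 1) / 2) +
          (m + 2) * (m + 1) * m * (3 * m + 5) / 24 =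
          ((m : ℚ) + 2) * (m + 1) / 2 * x ^ 2 -
          (((m : ℚ) + 2) * (m + 1) * (1 + s) + (m + 1) * ((m + 2) * (m + 1) / 2)) * x +
          (((m : ℚ) + 2) * (m + 1) / 2 * (1 + s) ^ 2 +
            (m + 1) * (1 + s) * ((m + 2) * (m + 1) / 2) +
            (m + 2) * (m + 1) * m * (3 * m + 5) / 24) := fun x => by ring
      simp only [e, sum_add_distrib, sum_sub_distrib, ← mul_sum, sum_const, nsmul_eq_mul,
        card_alternatingPerms, h3]
      linear_combination (((m : ℚ) + 2) * (m + 1) / 4 -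
        (((m : ℚ) + 2) * (m + 1) * (1 + s) + (m + 1) * ((m + 2) * (m + 1) / 2)) / 2) * h1
    rw [this, Nat.factorial_succ, Nat.factorial_succ]
    push_cast
    field_simp
    ring

theorem Polynomial.exists_eq_add_of_coeff_eq {P : ℚ[X]} {m : ℕ} {a b c : ℚ}
    (hP : P.natDegree ≤ m + 2) (ha : P.coeff (m + 2) = a) (hb : P.coeff (m + 1) = b)
    (hc : P.coeff m = c) : ∃ R : ℚ[X], R.degree < (m : WithBot ℕ) ∧
      P = C a * X ^ (m + 2) + C b * X ^ (m + 1) + C c * X ^ m + R := by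
  refine ⟨P - (C a * X ^ (m + 2) + C b * X ^ (m + 1) + C c * X ^ m), ?_, by ring⟩
  rw [degree_lt_iff_coeff_zero]
  intro j hj
  simp only [coeff_sub, coeff_add, coeff_C_mul, coeff_X_pow]
  obtain rfl | rfl | rfl | h : j = m ∨ j = m + 1 ∨ j = m + 2 ∨ m + 2 < j := by omega
  · simp [hc]
  · simp [hb]
  · simp [ha]
  · rw [coeff_eq_zero_of_natDegree_lt (hP.trans_lt h)]
    simp [h.ne', show j ≠ m by omega, show j ≠ m + 1 by omega]

theorem mainTheorem6 (d : ℕ) (hd : 2 ≤ d) :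
    ∃ P : ℚ[X], IsEhrhartPolynomial (fibonacciPolytope d) P ∧
      (∃ R : ℚ[X], R.degree < ((d - 2 : ℕ) : WithBot ℕ) ∧
        P = C (eulerZigzag d / (d.factorial : ℚ)) * X ^ d
          + C (3 / 2 * (eulerZigzag d / ((d - 1).factorial : ℚ))) * X ^ (d - 1)
          + C (1 / ((d - 2).factorial : ℚ) *
              (eulerZigzag d * ((-3 * (d : ℚ) ^ 2 + 17 * (d : ℚ) + 2) / 24)
                + ∑ m ∈ Finset.range (d - 1), (m.choose 2 : ℚ) * (swapCount d m : ℚ)))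
            * X ^ (d - 2)
          + R) ∧
      (∃ R : ℚ[X], R.degree < ((d - 2 : ℕ) : WithBot ℕ) ∧
        P.comp (X - C (3 / 2)) = C (eulerZigzag d / (d.factorial : ℚ)) * X ^ d
          + C (1 / ((d - 2).factorial : ℚ) *
              (eulerZigzag d * ((-3 * (d : ℚ) ^ 2 + 17 * (d : ℚ) - 25) / 24)
                + ∑ m ∈ Finset.range (d - 1), (m.choose 2 : ℚ) * (swapCount d m : ℚ)))
            * X ^ (d - 2)
          + R) := by
  obtain ⟨m, rfl⟩ : ∃ m, d = m + 2 := ⟨d - 2, by omega⟩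
  have e1 : m + 2 - 1 = m + 1 := by omega
  have e2 : m + 2 - 2 = m := by omega
  rw [e1, e2]
  refine ⟨shiftedEhrhart (m + 2) 0, isEhrhartPolynomial_shiftedEhrhart (m + 1), ?_, ?_⟩
  · obtain ⟨h1, h2, h3⟩ := coeff_shiftedEhrhart_top m 0
    refine exists_eq_add_of_coeff_eq (natDegree_shiftedEhrhart_le _ _) h1 ?_ ?_
    · rw [h2]
      ring
    · rw [h3]
      push_cast
      ring
  -- At `s = -3/2` the factor `s + 3/2` vanishes and `s (s + 3) / 2 = -27/24`, which turns the
  -- constant `2` into `-25`.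
  · obtain ⟨h1, h2, h3⟩ := coeff_shiftedEhrhart_top m (0 - 3 / 2)
    rw [shiftedEhrhart_comp]
    obtain ⟨R, hR, h⟩ := exists_eq_add_of_coeff_eq (natDegree_shiftedEhrhart_le _ _) h1 h2 h3
    refine ⟨R, hR, h.trans ?_⟩
    rw [show (0 - 3 / 2 + 3 / 2 : ℚ) = 0 by norm_num, zero_mul, C_0, zero_mul, add_zero]
    congr 5
    push_cast
    ring
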